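/- A Gr-category is a monoidal category in which every morphism is invertible and every object $x$ has an object $y$ with $x\otimes y\cong I\cong y\otimes x$; it is skeletal if isomorphic objects are equal. Let $\mathcal G$ be a skeletal Gr-category. Its objects form a group $G$ under $\otimes$ with unit $I$; $A=\mathrm{Aut}(I)$ is an abelian group, written additively; $G$ acts on $A$ by group automorphisms via $$\rho(g)(a)=1_g\otimes a\otimes 1_{g^{-1}},$$ an automorphism of $g\otimes I\otimes g^{-1}=I$; and the associator $\alpha_{g_1,g_2,g_3}\colon (g_1\otimes g_2)\otimes g_3\to g_1\otimes(g_2\otimes g_3)$ gives a map $$\alpha\colon G^3\to A,\qquad \alpha(g_1,g_2,g_3)=\alpha_{g_1,g_2,g_3}\otimes 1_{(g_1g_2g_3)^{-1}},$$ where equal objects are identified. **Theorem.** For every skeletal Gr-category the map $\alpha$ is a 3-cocycle: for all $g_0,g_1,g_2,g_3\in G$, $$\rho(g_0)\alpha(g_1,g_2,g_3)-\alpha(g_0g_1,g_2,g_3)+\alpha(g_0,g_1g_2,g_3)-\alpha(g_0,g_1,g_2g_3)+\alpha(g_0,g_1,g_2)=0 .$$ Let $\mathcal G$ and $\mathcal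 G'$ be skeletal Gr-categories giving $(G,A,\rho,\alpha)$ and $(G',A',\rho',\alpha')$. Then $\mathcal G$ and $\mathcal G'$ are equivalent as monoidal categories (that is, there are strong monoidal functors $F\colon\mathcal G\to\mathcal G'$ and $K\colon\mathcal G'\to\mathcal G$ with monoidal natural isomorphisms $KF\cong 1_{\mathcal G}$ and $FK\cong 1_{\mathcal G'}$) if and only if there exist group isomorphisms $\phi\colon G\to G'$ and $\psi\colon A\to A'$ such that - $\rho'(\phi(g))(\psi(a))=\psi(\rho(g)(a))$ for all $g\in G$, $a\in A$, and - there is a map $f\colon G'^2\to A'$ such that for all $g_1,g_2,g_3\in G$ $$\alpha'(\phi(g_1),\phi(g_2),\phi(g_3))-\psi(\alpha(g_1,g_2,g_3))=(df)(\phi(g_1),\phi(g_2),\phi(g_3)),$$ where $(df)(h_1,h_2,h_3)=\rho'(h_1)f(h_2,h_3)-f(h_1h_2,h_3)+f(h_1,h_2h_3)-f(h_1,h_2)$. The second condition says that $\alpha$, transported along $\phi$ and $\psi$, and $\alpha'$ define the same class in $H^3(G',A')$. -/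

import Mathlib

open CategoryTheory MonoidalCategory

universe v₁ v₂ u₁ u₂ v u

/-- A Gr-category (2-group): a monoidal category in which every morphism is invertible and
every object has a tensor inverse up to isomorphism. -/
class IsGrCategory (C : Type u) [Category.{v} C] [MonoidalCategory C] : Prop where
  isIso_hom : ∀ {X Y : C} (f : X ⟶ Y), IsIso f
  exists_inverse : ∀ X : C, ∃ Y : C, Nonempty (X ⊗ Y ≅ 𝟙_ C) ∧ Nonempty (Y ⊗ X ≅ 𝟙_ C)

/-- A skeletal Gr-category: a Gr-category in which isomorphic objects are equal. -/
class IsSkeletalGrCategory (C : Type u) [Category.{v} C] [MonoidalCategory C] : Prop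
    extends IsGrCategory C where
  skeletal : Skeletal C

/-- Equivalence of monoidal categories: strong monoidal functors in both directions whose
composites are monoidally naturally isomorphic to the identity functors. -/
def MonoidallyEquivalent (C : Type u₁) [Category.{v₁} C] [MonoidalCategory C]
    (D : Type u₂) [Category.{v₂} D] [MonoidalCategory D] : Prop :=
  ∃ (F : C ⥤ D) (G : D ⥤ C) (_ : F.Monoidal) (_ : G.Monoidal)
    (η : F ⋙ G ≅ 𝟭 C) (ε : G ⋙ F ≅ 𝟭 D),
    NatTrans.IsMonoidal η.hom ∧ NatTrans.IsMonoidal ε.hom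

namespace GrCategory

section ObjGroup

variable (C : Type u)

/-- The underlying type of the group `G` of objects of a skeletal Gr-category. -/
def ObjGroup : Type u := C

variable {C}

/-- An element of the group of objects, regarded as an object. -/
def ObjGroup.toObj (g : ObjGroup C) : C := g

variable [Category.{v} C] [MonoidalCategory C] [IsSkeletalGrCategory C]

theorem eq_of_iso {X Y : C} (e : X ≅ Y) : X = Y :=
  IsSkeletalGrCategory.skeletal ⟨e⟩

/-- The objects form a group under `⊗`, with unit the unit object. -/
noncomputable instance : Group (ObjGroup C) where
  mul g h := (g.toObj ⊗ h.toObj : C)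
  one := (𝟙_ C : C)
  inv g := Classical.choose (IsGrCategory.exists_inverse g.toObj)
  mul_assoc g h k := eq_of_iso (C := C) (α_ g.toObj h.toObj k.toObj)
  one_mul g := eq_of_iso (C := C) (λ_ g.toObj)
  mul_one g := eq_of_iso (C := C) (ρ_ g.toObj)
  inv_mul_cancel g :=
    eq_of_iso (C := C) (Classical.choose_spec (IsGrCategory.exists_inverse g.toObj)).2.some

theorem toObj_mul (g h : ObjGroup C) : (g * h).toObj = g.toObj ⊗ h.toObj := rfl

theorem toObj_one : (1 : ObjGroup C).toObj = 𝟙_ C := rfl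

theorem tensor_inv_eq (g : ObjGroup C) : g.toObj ⊗ (g⁻¹).toObj = 𝟙_ C :=
  mul_inv_cancel g

end ObjGroup

section EndConj

variable {C : Type u} [Category.{v} C]

/-- Two endomorphisms are conjugate if an isomorphism carries one to the other. -/
def EndConj {X Y : C} (x : X ⟶ X) (y : Y ⟶ Y) : Prop :=
  ∃ t : X ≅ Y, x ≫ t.hom = t.hom ≫ y

theorem EndConj.symm {X Y : C} {x : X ⟶ X} {y : Y ⟶ Y} (h : EndConj x y) : EndConj y x := by
  obtain ⟨t, ht⟩ := h
  exact ⟨t.symm, by simp [Iso.eq_inv_comp, ← reassoc_of% ht]⟩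

theorem EndConj.trans {X Y Z : C} {x : X ⟶ X} {y : Y ⟶ Y} {z : Z ⟶ Z}
    (h : EndConj x y) (h' : EndConj y z) : EndConj x z := by
  obtain ⟨t, ht⟩ := h
  obtain ⟨s, hs⟩ := h'
  exact ⟨t ≪≫ s, by simp [reassoc_of% ht, hs]⟩

end EndConj

section UnitAut

variable (C : Type u) [Category.{v} C] [MonoidalCategory C]

/-- The group `A = Aut(I)` of automorphisms of the unit object, written additively. -/
abbrev UnitAut : Type v := Additive (Aut (𝟙_ C))

variable {C}

theorem unit_comp_comm (f g : 𝟙_ C ⟶ 𝟙_ C) : f ≫ g = g ≫ f := by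
  have h := whisker_exchange f g
  have hf : 𝟙_ C ◁ f = f ▷ 𝟙_ C := by simp [unitors_equal, unitors_inv_equal]
  have hg : 𝟙_ C ◁ g = g ▷ 𝟙_ C := by simp [unitors_equal, unitors_inv_equal]
  rw [hg, ← comp_whiskerRight, ← comp_whiskerRight, whiskerRight_iff] at h
  exact h.symm

instance : AddCommGroup (UnitAut C) where
  __ := (inferInstance : AddGroup (Additive (Aut (𝟙_ C))))
  add_comm a b := by
    apply Additive.toMul.injective
    apply Iso.ext
    exact unit_comp_comm _ _

theorem EndConj.whiskerLeft {X Y : C} {x : X ⟶ X} {y : Y ⟶ Y} (h : EndConj x y) (Z : C) :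
    EndConj (Z ◁ x) (Z ◁ y) := by
  obtain ⟨t, ht⟩ := h
  exact ⟨whiskerLeftIso Z t, by simp [← MonoidalCategory.whiskerLeft_comp, ht]⟩

theorem EndConj.whiskerRight {X Y : C} {x : X ⟶ X} {y : Y ⟶ Y} (h : EndConj x y) (Z : C) :
    EndConj (x ▷ Z) (y ▷ Z) := by
  obtain ⟨t, ht⟩ := h
  exact ⟨whiskerRightIso t Z, by simp [← comp_whiskerRight, ht]⟩

theorem toMul_add_hom (a b : UnitAut C) :
    (a + b).toMul.hom = b.toMul.hom ≫ a.toMul.hom := rfl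

/-- Conjugate endomorphisms of the unit object are equal. -/
theorem EndConj.eq {x y : 𝟙_ C ⟶ 𝟙_ C} (h : EndConj x y) : x = y := by
  obtain ⟨t, ht⟩ := h
  rw [unit_comp_comm x] at ht
  simpa using ht

theorem endConj_unit_whiskerLeft {X : C} (f : X ⟶ X) : EndConj (𝟙_ C ◁ f) f :=
  ⟨λ_ X, by simp⟩

theorem endConj_whiskerRight_unit {X : C} (f : X ⟶ X) : EndConj (f ▷ 𝟙_ C) f :=
  ⟨ρ_ X, by simp⟩

theorem endConj_whiskerLeft_tensor (X Y : C) {Z : C} (f : Z ⟶ Z) :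
    EndConj ((X ⊗ Y) ◁ f) (X ◁ (Y ◁ f)) :=
  ⟨α_ X Y Z, by simp⟩

theorem endConj_whiskerRight_tensor (X Y : C) {Z : C} (f : Z ⟶ Z) :
    EndConj (f ▷ (X ⊗ Y)) ((f ▷ X) ▷ Y) :=
  ⟨(α_ Z X Y).symm, by simp⟩

theorem endConj_whisker_assoc (X Y : C) {Z : C} (f : Z ⟶ Z) :
    EndConj ((X ◁ f) ▷ Y) (X ◁ (f ▷ Y)) :=
  ⟨α_ X Z Y, by simp⟩

theorem endConj_whiskerRight_congr {X Y Z : C} (f : Z ⟶ Z) (h : X = Y) :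
    EndConj (f ▷ X) (f ▷ Y) := by
  subst h
  exact ⟨Iso.refl _, by simp⟩

end UnitAut

section Action

variable {C : Type u} [Category.{v} C] [MonoidalCategory C] [IsSkeletalGrCategory C]

theorem tensor_unit_tensor_inv_eq (g : ObjGroup C) :
    (g.toObj ⊗ 𝟙_ C) ⊗ (g⁻¹).toObj = 𝟙_ C := by
  rw [← eq_of_iso (ρ_ g.toObj).symm, tensor_inv_eq]

/-- `ρ(g)(a) = 1_g ⊗ a ⊗ 1_{g⁻¹}`, an automorphism of `g ⊗ I ⊗ g⁻¹ = I`. -/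
noncomputable def rho (g : ObjGroup C) (a : UnitAut C) : UnitAut C :=
  Additive.ofMul <|
    (eqToIso (tensor_unit_tensor_inv_eq g)).symm ≪≫
      whiskerRightIso (whiskerLeftIso g.toObj a.toMul) (g⁻¹).toObj ≪≫
        eqToIso (tensor_unit_tensor_inv_eq g)

theorem rho_hom (g : ObjGroup C) (a : UnitAut C) :
    (rho g a).toMul.hom = eqToHom (tensor_unit_tensor_inv_eq g).symm ≫
      ((g.toObj ◁ a.toMul.hom) ▷ (g⁻¹).toObj) ≫ eqToHom (tensor_unit_tensor_inv_eq g) := rfl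

theorem rho_add (g : ObjGroup C) (a b : UnitAut C) : rho g (a + b) = rho g a + rho g b := by
  apply Additive.toMul.injective
  apply Iso.ext
  simp [rho_hom, toMul_add_hom, -toMul_add]

theorem rho_zero (g : ObjGroup C) : rho g (0 : UnitAut C) = 0 := by
  simpa using rho_add g (0 : UnitAut C) 0

theorem rho_conj (g : ObjGroup C) (a : UnitAut C) :
    EndConj (rho g a).toMul.hom ((g.toObj ◁ a.toMul.hom) ▷ (g⁻¹).toObj) := by
  refine EndConj.symm ⟨eqToIso (tensor_unit_tensor_inv_eq g), ?_⟩
  simp [rho_hom]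

/-- The action `ρ` of the group of objects on `Aut(I)` by group automorphisms. -/
noncomputable instance : DistribMulAction (ObjGroup C) (UnitAut C) where
  smul := rho
  one_smul a := by
    apply Additive.toMul.injective
    apply Iso.ext
    have e : ((1 : ObjGroup C)⁻¹).toObj = 𝟙_ C := by rw [inv_one]; rfl
    exact ((rho_conj 1 a).trans ((endConj_whiskerRight_congr _ e).trans
      ((endConj_whiskerRight_unit _).trans (endConj_unit_whiskerLeft _)))).eq
  mul_smul g h a := by
    apply Additive.toMul.injective
    apply Iso.ext
    have e : ((g * h)⁻¹).toObj = (h⁻¹).toObj ⊗ (g⁻¹).toObj := by rw [mul_inv_rev]; rfl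
    have h₁ : EndConj (((g * h).toObj ◁ a.toMul.hom) ▷ ((g * h)⁻¹).toObj)
        ((g.toObj ◁ ((h.toObj ◁ a.toMul.hom) ▷ (h⁻¹).toObj)) ▷ (g⁻¹).toObj) :=
      (endConj_whiskerRight_congr _ e).trans <| (endConj_whiskerRight_tensor _ _ _).trans <|
        EndConj.whiskerRight (((endConj_whiskerLeft_tensor _ _ _).whiskerRight _).trans
          (endConj_whisker_assoc _ _ _)) _
    exact ((rho_conj (g * h) a).trans (h₁.trans
      ((((rho_conj h a).whiskerLeft g.toObj).whiskerRight _).symm.trans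
        (rho_conj g (rho h a)).symm))).eq
  smul_zero g := rho_zero g
  smul_add g a b := rho_add g a b

theorem smul_def (g : ObjGroup C) (a : UnitAut C) : g • a = rho g a := rfl

theorem tensor_tensor_tensor_inv_eq (g₁ g₂ g₃ : ObjGroup C) :
    ((g₁.toObj ⊗ g₂.toObj) ⊗ g₃.toObj) ⊗ ((g₁ * g₂ * g₃)⁻¹).toObj = 𝟙_ C :=
  tensor_inv_eq (g₁ * g₂ * g₃)

theorem tensor_tensor_tensor_inv_eq' (g₁ g₂ g₃ : ObjGroup C) :
    (g₁.toObj ⊗ (g₂.toObj ⊗ g₃.toObj)) ⊗ ((g₁ * g₂ * g₃)⁻¹).toObj = 𝟙_ C := by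
  rw [← eq_of_iso (α_ g₁.toObj g₂.toObj g₃.toObj), tensor_tensor_tensor_inv_eq]

/-- The associator as a map `G³ → A`: the morphism `α_{g₁,g₂,g₃} ⊗ 1_{(g₁g₂g₃)⁻¹}`, whose source
and target are both equal to `I`. -/
noncomputable def associatorCochain (g₁ g₂ g₃ : ObjGroup C) : UnitAut C :=
  Additive.ofMul <|
    (eqToIso (tensor_tensor_tensor_inv_eq g₁ g₂ g₃)).symm ≪≫
      whiskerRightIso (α_ g₁.toObj g₂.toObj g₃.toObj) ((g₁ * g₂ * g₃)⁻¹).toObj ≪≫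
        eqToIso (tensor_tensor_tensor_inv_eq' g₁ g₂ g₃)

end Action

section Cochains

variable {G A : Type*} [Group G] [AddCommGroup A] [DistribMulAction G A]

/-- The 3-cocycle condition for a map `G³ → A`. -/
def IsThreeCocycle (a : G → G → G → A) : Prop :=
  ∀ g₀ g₁ g₂ g₃ : G,
    g₀ • a g₁ g₂ g₃ - a (g₀ * g₁) g₂ g₃ + a g₀ (g₁ * g₂) g₃ - a g₀ g₁ (g₂ * g₃)
      + a g₀ g₁ g₂ = 0

/-- The coboundary `df : G³ → A` of a map `f : G² → A`. -/
def coboundary (f : G → G → A) (g₁ g₂ g₃ : G) : A :=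
  g₁ • f g₂ g₃ - f (g₁ * g₂) g₃ + f g₁ (g₂ * g₃) - f g₁ g₂

end Cochains

end GrCategory

/-!
A morphism `u : X ⟶ Y` of a skeletal Gr-category is invertible, so `X = Y`, and tensoring with
`X⁻¹` turns `u` into an automorphism of the unit object, here called its *label*. Labels determine
morphisms (`label_injective`), every label occurs between equal objects (`exists_label_eq`),
composition adds labels (`label_comp`), and whiskering by `Z` on the right leaves the label
unchanged while whiskering on the left acts on it by `ρ(Z)` (`label_whiskerRight`,
`label_whiskerLeft`). A commutative diagram is thus the same thing as an equation in `A`, and no coherence isomorphism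
between equal objects has to be tracked.

The pentagon becomes the 3-cocycle condition. A strong monoidal equivalence `F` gives `φ` on objects
and `ψ` on labels (`label_map`), and its hexagon says that the associator cochains differ by the
coboundary of minus the label of the tensorator.

Conversely, `φ` and `ψ` define a functor with given action on objects and labels, which is fully
faithful and essentially surjective. The isomorphisms with labels `-f` serve as tensorator: they are
natural because `ψ` is equivariant, and the hexagon is the coboundary condition. The cochains are
not normalized and the unitors need not be identities, so unitality is a separate matter. The label
of the unit isomorphism is forced by left unitality at the unit object. Since `α(1, 1, g)` and
`α(g, 1, 1)` are given by labels of unitors (`associatorCochain_one_one`,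
`associatorCochain_one_right`), the coboundary condition at `(1, 1, g)` and `(g, 1, 1)` gives left
and right unitality at `g`.
-/

namespace GrCategory

/-! ### Labels of morphisms -/

theorem unitAut_ext {C : Type u} [Category.{v} C] [MonoidalCategory C] {a b : UnitAut C}
    (h : a.toMul.hom = b.toMul.hom) : a = b :=
  Additive.toMul.injective (Iso.ext h)

/-- An object of a skeletal Gr-category, regarded as an element of its group of objects. -/
def toGrp {C : Type u} (X : C) : ObjGroup C := X

theorem toObj_toGrp {C : Type u} (X : C) : (toGrp X).toObj = X := rfl

section Label

variable {C : Type u} [Category.{v} C] [MonoidalCategory C] [IsSkeletalGrCategory C]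

theorem toGrp_tensor (X Y : C) : toGrp (X ⊗ Y) = toGrp X * toGrp Y := rfl

theorem toGrp_unit : toGrp (𝟙_ C) = 1 := rfl

theorem isIso_of_isGrCategory {X Y : C} (u : X ⟶ Y) : IsIso u := IsGrCategory.isIso_hom u

theorem eq_of_hom {X Y : C} (u : X ⟶ Y) : X = Y :=
  haveI := isIso_of_isGrCategory u
  eq_of_iso (asIso u)

theorem tensor_toGrp_inv (X : C) : X ⊗ ((toGrp X)⁻¹).toObj = 𝟙_ C := tensor_inv_eq (toGrp X)

theorem toGrp_inv_tensor (X : C) : ((toGrp X)⁻¹).toObj ⊗ X = 𝟙_ C := inv_mul_cancel (toGrp X)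

theorem tensor_toGrp_inv_of_hom {X Y : C} (u : X ⟶ Y) :
    Y ⊗ ((toGrp X)⁻¹).toObj = 𝟙_ C := by
  rw [← eq_of_hom u, tensor_toGrp_inv]

/-- The label of a morphism `u : X ⟶ Y`: the automorphism `u ⊗ 1_{X⁻¹}` of the unit object.
Its source and target are identified with the unit object by equality of objects; `X = Y` holds
because every morphism is invertible and the category is skeletal. -/
noncomputable def label {X Y : C} (u : X ⟶ Y) : UnitAut C :=
  haveI := isIso_of_isGrCategory u
  Additive.ofMul <|
    (eqToIso (tensor_toGrp_inv X)).symm ≪≫ whiskerRightIso (asIso u) ((toGrp X)⁻¹).toObj ≪≫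
      eqToIso (tensor_toGrp_inv_of_hom u)

theorem label_hom {X Y : C} (u : X ⟶ Y) :
    (label u).toMul.hom = eqToHom (tensor_toGrp_inv X).symm ≫ u ▷ ((toGrp X)⁻¹).toObj ≫
      eqToHom (tensor_toGrp_inv_of_hom u) := rfl

theorem label_associator (g₁ g₂ g₃ : ObjGroup C) :
    label (α_ g₁.toObj g₂.toObj g₃.toObj).hom = associatorCochain g₁ g₂ g₃ :=
  unitAut_ext rfl

theorem label_comp {X Y Z : C} (u : X ⟶ Y) (w : Y ⟶ Z) : label (u ≫ w) = label u + label w := by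
  obtain rfl := eq_of_hom u
  obtain rfl := eq_of_hom w
  apply unitAut_ext
  rw [add_comm, toMul_add_hom]
  simp [label_hom]

theorem label_id (X : C) : label (𝟙 X) = 0 := by
  simpa using label_comp (𝟙 X) (𝟙 X)

/-- The label of an endomorphism is the automorphism of the unit object conjugate to
`u ⊗ 1_{X⁻¹}`, which determines it since conjugate endomorphisms of the unit object agree. -/
theorem endConj_label {X : C} (u : X ⟶ X) :
    EndConj (label u).toMul.hom (u ▷ ((toGrp X)⁻¹).toObj) := by
  refine EndConj.symm ⟨eqToIso (tensor_toGrp_inv X), ?_⟩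
  simp [label_hom]

theorem EndConj.label_eq {X Y : C} {x : X ⟶ X} {y : Y ⟶ Y} (h : EndConj x y) :
    label x = label y := by
  obtain ⟨t, ht⟩ := h
  have := congrArg label ht
  rw [label_comp, label_comp, add_comm] at this
  exact add_left_cancel this

theorem label_inv {X Y : C} (u : X ≅ Y) : label u.inv = - label u.hom := by
  rw [eq_neg_iff_add_eq_zero, ← label_comp, u.inv_hom_id, label_id]

/-- An automorphism of the unit object is its own label. -/
theorem label_unit (a : UnitAut C) : label a.toMul.hom = a := by
  apply unitAut_ext
  have e : ((toGrp (𝟙_ C))⁻¹).toObj = 𝟙_ C := inv_one (G := ObjGroup C)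
  exact ((endConj_label _).trans ((endConj_whiskerRight_congr _ e).trans
    (endConj_whiskerRight_unit _))).eq

theorem label_whiskerRight {X Y : C} (u : X ⟶ Y) (Z : C) : label (u ▷ Z) = label u := by
  obtain rfl := eq_of_hom u
  apply unitAut_ext
  have e : Z ⊗ ((toGrp (X ⊗ Z))⁻¹).toObj = ((toGrp X)⁻¹).toObj := by
    change toGrp Z * (toGrp X * toGrp Z)⁻¹ = (toGrp X)⁻¹
    simp
  exact ((endConj_label _).trans ((endConj_whiskerRight_tensor _ _ _).symm.trans
    ((endConj_whiskerRight_congr _ e).trans (endConj_label _).symm))).eq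

theorem label_whiskerLeft (Z : C) {X Y : C} (u : X ⟶ Y) :
    label (Z ◁ u) = toGrp Z • label u := by
  obtain rfl := eq_of_hom u
  apply unitAut_ext
  have e : ((toGrp (Z ⊗ X))⁻¹).toObj = ((toGrp X)⁻¹).toObj ⊗ ((toGrp Z)⁻¹).toObj := by
    change (toGrp Z * toGrp X)⁻¹ = (toGrp X)⁻¹ * (toGrp Z)⁻¹
    simp
  exact ((endConj_label _).trans ((endConj_whiskerRight_congr _ e).trans
    ((endConj_whiskerRight_tensor _ _ _).trans (((endConj_whisker_assoc _ _ _).trans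
      ((endConj_label u).symm.whiskerLeft Z)).whiskerRight _)))).trans
        (rho_conj (toGrp Z) (label u)).symm |>.eq

/-- Labels determine morphisms, since tensoring with an invertible object is faithful. -/
theorem label_injective {X Y : C} : Function.Injective (label : (X ⟶ Y) → UnitAut C) := by
  intro u w h
  obtain rfl := eq_of_hom u
  have h₁ : u ▷ ((toGrp X)⁻¹).toObj = w ▷ ((toGrp X)⁻¹).toObj := by
    have := congrArg (fun a : UnitAut C => a.toMul.hom) h
    simp only [label_hom] at this
    rwa [cancel_epi, cancel_mono] at this
  -- Tensoring with `X` as well whiskers `u` and `w` with an object equal to the unit object.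
  have h₂ : u ▷ (((toGrp X)⁻¹).toObj ⊗ X) = w ▷ (((toGrp X)⁻¹).toObj ⊗ X) := by
    simp [whiskerRight_tensor, h₁]
  rwa [toGrp_inv_tensor, whiskerRight_iff] at h₂

/-- A label `a` is realized on `X` by whiskering `a` with `X` and conjugating by the left unitor. -/
theorem exists_label_eq {X Y : C} (h : X = Y) (a : UnitAut C) : ∃ u : X ⟶ Y, label u = a := by
  subst h
  refine ⟨(λ_ X).inv ≫ a.toMul.hom ▷ X ≫ (λ_ X).hom, ?_⟩
  rw [label_comp, label_comp, label_whiskerRight, label_unit, label_inv]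
  abel

/-- The morphism between equal objects with a given label. -/
noncomputable def homOfLabel {X Y : C} (h : X = Y) (a : UnitAut C) : X ⟶ Y :=
  (exists_label_eq h a).choose

@[simp]
theorem label_homOfLabel {X Y : C} (h : X = Y) (a : UnitAut C) : label (homOfLabel h a) = a :=
  (exists_label_eq h a).choose_spec

/-- The isomorphism between equal objects with a given label. -/
noncomputable def isoOfLabel {X Y : C} (h : X = Y) (a : UnitAut C) : X ≅ Y where
  hom := homOfLabel h a
  inv := homOfLabel h.symm (-a)
  hom_inv_id := label_injective (by simp [label_comp, label_id])
  inv_hom_id := label_injective (by simp [label_comp, label_id])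

@[simp]
theorem label_isoOfLabel_hom {X Y : C} (h : X = Y) (a : UnitAut C) :
    label (isoOfLabel h a).hom = a := label_homOfLabel h a

/-! ### The associator cochain -/

/-- The labels of the two sides of the pentagon give the cocycle condition. -/
theorem isThreeCocycle_associatorCochain :
    IsThreeCocycle (associatorCochain (C := C)) := by
  intro g₀ g₁ g₂ g₃
  have h := congrArg label (pentagon g₀.toObj g₁.toObj g₂.toObj g₃.toObj)
  simp only [label_comp, label_whiskerRight, label_whiskerLeft] at h
  have h' : associatorCochain g₀ g₁ g₂ + (associatorCochain g₀ (g₁ * g₂) g₃ +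
      g₀ • associatorCochain g₁ g₂ g₃) =
      associatorCochain (g₀ * g₁) g₂ g₃ + associatorCochain g₀ g₁ (g₂ * g₃) := by
    simp only [← label_associator]
    exact h
  rw [← sub_eq_zero] at h'
  rw [← h']
  abel

theorem label_leftUnitor_congr {X Y : C} (h : X = Y) :
    label (λ_ X).hom = label (λ_ Y).hom := by
  rw [h]

/-- The associator with two unit arguments is expressed by unitors, as
`λ_{1 ⊗ g} = α_{1,1,g}⁻¹ ≫ (λ_1 ▷ g)`. -/
theorem associatorCochain_one_one (g : ObjGroup C) :
    associatorCochain 1 1 g = label (λ_ (𝟙_ C)).hom - label (λ_ g.toObj).hom := by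
  have h := congrArg label (leftUnitor_tensor_hom (𝟙_ C) g.toObj)
  rw [label_comp, label_whiskerRight, label_inv] at h
  have e : label (λ_ (𝟙_ C ⊗ g.toObj)).hom = label (λ_ g.toObj).hom := by
    exact label_leftUnitor_congr (eq_of_iso (λ_ g.toObj))
  rw [e] at h
  rw [h, ← label_associator]
  simp [toObj_one]

/-- The triangle identity for `g` and the unit object, in labels. -/
theorem associatorCochain_one_right (g : ObjGroup C) :
    associatorCochain g 1 1 = label (ρ_ g.toObj).hom - g • label (λ_ (𝟙_ C)).hom := by
  have h := congrArg label (triangle g.toObj (𝟙_ C))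
  rw [label_comp, label_whiskerRight, label_whiskerLeft] at h
  rw [eq_sub_iff_add_eq, ← h, ← label_associator]
  rfl

end Label

/-! ### Invariants of a monoidal equivalence -/

section OfEquivalence

open Functor.LaxMonoidal

variable {C : Type u₁} [Category.{v₁} C] [MonoidalCategory C] [IsSkeletalGrCategory C]
variable {D : Type u₂} [Category.{v₂} D] [MonoidalCategory D] [IsSkeletalGrCategory D]

theorem EndConj.map {C : Type u₁} [Category.{v₁} C] {D : Type u₂} [Category.{v₂} D] (F : C ⥤ D)
    {X Y : C} {x : X ⟶ X} {y : Y ⟶ Y} (h : EndConj x y) : EndConj (F.map x) (F.map y) := by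
  obtain ⟨t, ht⟩ := h
  exact ⟨F.mapIso t, by rw [F.mapIso_hom, ← F.map_comp, ht, F.map_comp]⟩

theorem endConj_map_whiskerRight {C : Type u₁} [Category.{v₁} C] [MonoidalCategory C]
    {D : Type u₂} [Category.{v₂} D] [MonoidalCategory D] (F : C ⥤ D) [F.Monoidal] {X : C}
    (u : X ⟶ X) (Z : C) :
    EndConj (F.map (u ▷ Z)) (F.map u ▷ F.obj Z) :=
  EndConj.symm ⟨Functor.Monoidal.μIso F X Z, by simp⟩

theorem endConj_map_whiskerLeft {C : Type u₁} [Category.{v₁} C] [MonoidalCategory C]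
    {D : Type u₂} [Category.{v₂} D] [MonoidalCategory D] (F : C ⥤ D) [F.Monoidal] (Z : C)
    {X : C} (u : X ⟶ X) :
    EndConj (F.map (Z ◁ u)) (F.obj Z ◁ F.map u) :=
  EndConj.symm ⟨Functor.Monoidal.μIso F Z X, by simp⟩

variable (F : C ⥤ D)

/-- The map `Aut(I) → Aut(I')` induced by a functor, as a homomorphism: an automorphism is sent
to the label of its image. -/
@[simps]
noncomputable def mapUnitAut : UnitAut C →+ UnitAut D where
  toFun a := label (F.map a.toMul.hom)
  map_zero' := by
    change label (F.map (𝟙 _)) = 0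
    rw [F.map_id, label_id]
  map_add' a b := by
    rw [add_comm, toMul_add_hom, F.map_comp, label_comp]

theorem mapUnitAut_bijective [F.Full] [F.Faithful] : Function.Bijective (mapUnitAut F) := by
  constructor
  · intro a b h
    exact unitAut_ext (F.map_injective (label_injective h))
  · intro b
    obtain ⟨w, hw⟩ := exists_label_eq (rfl : F.obj (𝟙_ C) = _) b
    obtain ⟨u, rfl⟩ := F.map_surjective w
    have := isIso_of_isGrCategory u
    exact ⟨Additive.ofMul (asIso u), hw⟩

variable [F.Monoidal]

/-- A strong monoidal functor acts on all labels through its effect on the unit object. -/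
theorem label_map {X Y : C} (u : X ⟶ Y) : label (F.map u) = mapUnitAut F (label u) := by
  obtain rfl := eq_of_hom u
  rw [mapUnitAut_apply, (EndConj.map F (endConj_label u)).label_eq,
    (endConj_map_whiskerRight F u _).label_eq, label_whiskerRight]

theorem mapUnitAut_smul (g : ObjGroup C) (a : UnitAut C) :
    mapUnitAut F (g • a) = toGrp (F.obj g.toObj) • mapUnitAut F a := by
  rw [mapUnitAut_apply F a, ← label_whiskerLeft, ← (endConj_map_whiskerLeft F _ _).label_eq,
    label_map, label_whiskerLeft, label_unit]
  rfl

/-- The homomorphism on groups of objects induced by a strong monoidal functor. -/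
noncomputable def mapObjGroup : ObjGroup C →* ObjGroup D :=
  MonoidHom.mk' (fun g => toGrp (F.obj g.toObj))
    fun g h => (eq_of_iso (Functor.Monoidal.μIso F g.toObj h.toObj)).symm

theorem mapObjGroup_bijective [F.IsEquivalence] : Function.Bijective (mapObjGroup F) := by
  constructor
  · intro g h e
    have e' : F.obj g.toObj = F.obj h.toObj := e
    exact eq_of_iso (C := C) (F.preimageIso (eqToIso e'))
  · intro h
    exact ⟨toGrp (F.objPreimage h.toObj), eq_of_iso (C := D) (F.objObjPreimageIso h.toObj)⟩

/-- The labels of the hexagon for the tensorator `μ`: the associator cochains differ by the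
coboundary of the negative of the label of `μ`. -/
theorem label_associator_map (g₁ g₂ g₃ : ObjGroup C) :
    associatorCochain (mapObjGroup F g₁) (mapObjGroup F g₂) (mapObjGroup F g₃)
        + mapObjGroup F g₁ • label (μ F g₂.toObj g₃.toObj)
        + label (μ F g₁.toObj (g₂ * g₃).toObj) =
      label (μ F g₁.toObj g₂.toObj) + label (μ F (g₁ * g₂).toObj g₃.toObj)
        + mapUnitAut F (associatorCochain g₁ g₂ g₃) := by
  have h := congrArg label (associativity F g₁.toObj g₂.toObj g₃.toObj)
  simp only [label_comp, label_whiskerRight, label_whiskerLeft, label_map] at h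
  rw [add_assoc, add_assoc, ← label_associator, ← label_associator]
  exact h.symm

/-- The invariants preserved by a strong monoidal equivalence: `φ` is its effect on objects, `ψ` its
effect on labels, and `f` is minus the label of its tensorator. -/
theorem exists_data_of_isEquivalence [F.IsEquivalence] :
    ∃ (φ : ObjGroup C ≃* ObjGroup D) (ψ : UnitAut C ≃+ UnitAut D),
      (∀ (g : ObjGroup C) (a : UnitAut C), φ g • ψ a = ψ (g • a)) ∧
      ∃ f : ObjGroup D → ObjGroup D → UnitAut D, ∀ g₁ g₂ g₃ : ObjGroup C,
        associatorCochain (φ g₁) (φ g₂) (φ g₃) - ψ (associatorCochain g₁ g₂ g₃)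
          = coboundary f (φ g₁) (φ g₂) (φ g₃) := by
  let φ := MulEquiv.ofBijective (mapObjGroup F) (mapObjGroup_bijective F)
  let ψ := AddEquiv.ofBijective (mapUnitAut F) (mapUnitAut_bijective F)
  refine ⟨φ, ψ, fun g a => (mapUnitAut_smul F g a).symm, ?_⟩
  -- The label of `μ` as a function of group elements, so that equalities in the group rewrite it.
  obtain ⟨m, hm⟩ : ∃ m : ObjGroup C → ObjGroup C → UnitAut D,
      ∀ g h, label (μ F g.toObj h.toObj) = m g h := ⟨_, fun _ _ => rfl⟩
  refine ⟨fun h₁ h₂ => - m (φ.symm h₁) (φ.symm h₂), fun g₁ g₂ g₃ => ?_⟩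
  have h := label_associator_map F g₁ g₂ g₃
  have hφ : ∀ g, mapObjGroup F g = φ g := fun _ => rfl
  have hψ : ∀ a, mapUnitAut F a = ψ a := fun _ => rfl
  rw [hφ, hφ, hφ, hψ, ← eq_sub_iff_add_eq, ← eq_sub_iff_add_eq] at h
  simp only [hm] at h
  simp only [coboundary, ← map_mul, MulEquiv.symm_apply_apply, smul_neg]
  rw [h]
  abel

end OfEquivalence

/-! ### The monoidal equivalence determined by cohomological data -/

/-- The inverse of a strong monoidal functor that is an equivalence is strong monoidal, and the
unit and counit are monoidal. -/
theorem monoidallyEquivalent_of_equivalence {C : Type u₁} [Category.{v₁} C] [MonoidalCategory C]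
    {D : Type u₂} [Category.{v₂} D] [MonoidalCategory D] (e : C ≌ D) [e.functor.Monoidal] :
    MonoidallyEquivalent C D := by
  -- The lax structure underlying `inverseMonoidal` is the one on a right adjoint.
  have h : @Adjunction.IsMonoidal _ _ _ _ _ _ _ _ e.toAdjunction _
      e.toAdjunction.rightAdjointLaxMonoidal := inferInstance
  let := e.inverseMonoidal
  have : e.IsMonoidal := h
  have : NatTrans.IsMonoidal e.unitIso.hom := inferInstanceAs (NatTrans.IsMonoidal e.unit)
  exact ⟨e.functor, e.inverse, inferInstance, inferInstance, e.unitIso.symm, e.counitIso,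
    inferInstanceAs (NatTrans.IsMonoidal e.unitIso.inv),
    inferInstanceAs (NatTrans.IsMonoidal e.counit)⟩

section ToEquivalence

variable {C : Type u₁} [Category.{v₁} C] [MonoidalCategory C] [IsSkeletalGrCategory C]
variable {D : Type u₂} [Category.{v₂} D] [MonoidalCategory D] [IsSkeletalGrCategory D]
variable (φ : ObjGroup C ≃* ObjGroup D) (ψ : UnitAut C ≃+ UnitAut D)

/-- The functor acting on objects by `φ` and on labels of morphisms by `ψ`. -/
noncomputable def functorOfData : C ⥤ D where
  obj X := (φ (toGrp X)).toObj
  map {X Y} u := homOfLabel (congrArg (fun Z : C => (φ (toGrp Z)).toObj) (eq_of_hom u))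
    (ψ (label u))
  map_id X := label_injective (by simp [label_id])
  map_comp u w := label_injective (by simp [label_comp])

theorem label_functorOfData_map {X Y : C} (u : X ⟶ Y) :
    label ((functorOfData φ ψ).map u) = ψ (label u) := by
  rw [functorOfData, label_homOfLabel]

theorem functorOfData_obj (X : C) : (functorOfData φ ψ).obj X = (φ (toGrp X)).toObj := rfl

theorem toGrp_functorOfData_obj (X : C) : toGrp ((functorOfData φ ψ).obj X) = φ (toGrp X) :=
  rfl

instance functorOfData_isEquivalence : (functorOfData φ ψ).IsEquivalence where
  faithful := ⟨fun {X Y u w} h => label_injective (ψ.injective (by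
    rw [← label_functorOfData_map φ, h, label_functorOfData_map]))⟩
  full := ⟨fun {X Y} w => by
    have e : X = Y := φ.injective (eq_of_hom (C := D) w)
    exact ⟨homOfLabel (C := C) e (ψ.symm (label w)), label_injective (by
      rw [label_functorOfData_map, label_homOfLabel, ψ.apply_symm_apply])⟩⟩
  essSurj := ⟨fun Y => ⟨(φ.symm (toGrp Y)).toObj,
    ⟨eqToIso (C := D) (φ.apply_symm_apply (toGrp Y))⟩⟩⟩

theorem functorOfData_obj_tensor (X Y : C) :
    (functorOfData φ ψ).obj X ⊗ (functorOfData φ ψ).obj Y = (functorOfData φ ψ).obj (X ⊗ Y) :=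
  (map_mul φ (toGrp X) (toGrp Y)).symm

theorem functorOfData_obj_unit : 𝟙_ D = (functorOfData φ ψ).obj (𝟙_ C) :=
  (map_one φ).symm

/-- The functor given by `φ` and `ψ` is strong monoidal, with tensorator labelled by `-f`. The
label of its unit isomorphism is forced by left unitality at the unit object; unitality at the
other objects is the coboundary condition with two arguments equal to `1`. -/
noncomputable def functorOfDataCoreMonoidal
    (hψ : ∀ (g : ObjGroup C) (a : UnitAut C), φ g • ψ a = ψ (g • a))
    (f : ObjGroup D → ObjGroup D → UnitAut D)
    (hf : ∀ g₁ g₂ g₃ : ObjGroup C,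
      associatorCochain (φ g₁) (φ g₂) (φ g₃) - ψ (associatorCochain g₁ g₂ g₃)
        = coboundary f (φ g₁) (φ g₂) (φ g₃)) :
    (functorOfData φ ψ).CoreMonoidal where
  εIso := isoOfLabel (functorOfData_obj_unit φ ψ)
    (label (λ_ (𝟙_ D)).hom - ψ (label (λ_ (𝟙_ C)).hom) + f 1 1)
  μIso X Y := isoOfLabel (functorOfData_obj_tensor φ ψ X Y) (- f (φ (toGrp X)) (φ (toGrp Y)))
  μIso_hom_natural_left {X Y} u Z := by
    obtain rfl := eq_of_hom u
    apply label_injective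
    simp only [label_comp, label_whiskerRight, label_functorOfData_map, label_isoOfLabel_hom]
    exact add_comm _ _
  μIso_hom_natural_right {X Y} Z u := by
    obtain rfl := eq_of_hom u
    apply label_injective
    simp only [label_comp, label_whiskerLeft, label_functorOfData_map, label_isoOfLabel_hom,
      ← hψ, toGrp_functorOfData_obj]
    exact add_comm _ _
  associativity X Y Z := by
    apply label_injective
    have h := hf (toGrp X) (toGrp Y) (toGrp Z)
    rw [coboundary, ← map_mul, ← map_mul, ← label_associator, ← label_associator,
      sub_eq_iff_eq_add] at h
    simp only [label_comp, label_whiskerRight, label_whiskerLeft, label_functorOfData_map,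
      label_isoOfLabel_hom, toGrp_functorOfData_obj, smul_neg]
    simp only [functorOfData_obj, h, toGrp_tensor, toObj_toGrp]
    abel
  left_unitality X := by
    apply label_injective
    have h := hf 1 1 (toGrp X)
    simp only [coboundary, map_one, associatorCochain_one_one, map_sub, one_mul, one_smul,
      sub_self, zero_add, toObj_toGrp] at h
    simp only [label_comp, label_whiskerRight, label_functorOfData_map, label_isoOfLabel_hom]
    simp only [toGrp_unit, map_one, functorOfData_obj]
    rw [← sub_eq_zero] at h ⊢
    rw [← neg_eq_zero, ← h]
    abel
  right_unitality X := by
    apply label_injective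
    have h := hf (toGrp X) 1 1
    simp only [coboundary, map_one, associatorCochain_one_right, map_sub, mul_one, ← hψ,
      toObj_toGrp] at h
    simp only [label_comp, label_whiskerLeft, label_functorOfData_map, label_isoOfLabel_hom,
      toGrp_functorOfData_obj, smul_add, smul_sub]
    simp only [toGrp_unit, map_one, functorOfData_obj]
    rw [← sub_eq_zero] at h ⊢
    rw [← h]
    abel

end ToEquivalence
end GrCategory

theorem theoremA3
    (C : Type u₁) [Category.{v₁} C] [MonoidalCategory C] [IsSkeletalGrCategory C]
    (D : Type u₂) [Category.{v₂} D] [MonoidalCategory D] [IsSkeletalGrCategory D] :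
    GrCategory.IsThreeCocycle (GrCategory.associatorCochain (C := C)) ∧
    GrCategory.IsThreeCocycle (GrCategory.associatorCochain (C := D)) ∧
    (MonoidallyEquivalent C D ↔
      ∃ (φ : GrCategory.ObjGroup C ≃* GrCategory.ObjGroup D)
        (ψ : GrCategory.UnitAut C ≃+ GrCategory.UnitAut D),
        (∀ (g : GrCategory.ObjGroup C) (a : GrCategory.UnitAut C), φ g • ψ a = ψ (g • a)) ∧
        ∃ f : GrCategory.ObjGroup D → GrCategory.ObjGroup D → GrCategory.UnitAut D,
          ∀ g₁ g₂ g₃ : GrCategory.ObjGroup C,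
            GrCategory.associatorCochain (φ g₁) (φ g₂) (φ g₃)
                - ψ (GrCategory.associatorCochain g₁ g₂ g₃)
              = GrCategory.coboundary f (φ g₁) (φ g₂) (φ g₃)) := by
  refine ⟨GrCategory.isThreeCocycle_associatorCochain,
    GrCategory.isThreeCocycle_associatorCochain, ?_, ?_⟩
  · rintro ⟨F, G, hF, -, η, ε, -, -⟩
    have : F.IsEquivalence := (CategoryTheory.Equivalence.mk F G η.symm ε).isEquivalence_functor
    exact GrCategory.exists_data_of_isEquivalence F
  · rintro ⟨φ, ψ, hψ, f, hf⟩
    let := (GrCategory.functorOfDataCoreMonoidal φ ψ hψ f hf).toMonoidal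
    exact @GrCategory.monoidallyEquivalent_of_equivalence _ _ _ _ _ _
      (GrCategory.functorOfData φ ψ).asEquivalence this
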